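/- Let $F$ be a probability distribution on $\mathbb{R}$ (the law of a running variable $x$) with $\mathbb{E}(x)=0$, $\operatorname{Var}(x)>0$ and $\mathbb{E}(|x|^3)<\infty$. A design function is a measurable $p:\mathbb{R}\to[0,1]$; $\mathbb{E}_p$ denotes expectation when $x\sim F$ and, given $x$, the treatment indicator $z\in\{-1,1\}$ equals $1$ with probability $p(x)$. For $\sigma>0$ let $\mathcal{I}(p)=\sigma^{-2}\,\mathbb{E}_p(XX^{\top})\in\mathbb{R}^{4\times4}$ with $X=(1,x,z,xz)^{\top}$. For $-1<\widetilde z<1$ let $\widetilde{xz}_{\max}(\widetilde z)$ be the supremum of $\mathbb{E}_p(xz)$ over the design functions $p$ with $\mathbb{E}_p(z)=\widetilde z$, and let $$\mathcal{J}=\{(\widetilde z,\widetilde{xz}) : -1<\widetilde z<1,\ 0\le\widetilde{xz}\le\widetilde{xz}_{\max}(\widetilde z)\}.$$ Let $(\widetilde z,\widetilde{xz})\in\mathcal{J}$; call a design function $p$ feasible if $\mathbb{E}_p(z)=\widetilde z$ and $\mathbb{E}_p(xz)=\widetilde{xz}$. Let $\Psi$ be a function with values in $[-\infty,\infty]$ that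 is continuous on the set of matrices $\mathcal{I}(p)$ of design functions $p$ with $(\mathbb{E}_p(z),\mathbb{E}_p(xz))\in\mathcal{J}$. Then there are $a_1\le a_2\le a_3$ in $[-\infty,\infty]$ and a feasible design function $p_{\mathrm{opt}}$ that maximizes $\Psi(\mathcal{I}(p))$ over all feasible design functions $p$, such that $$p_{\mathrm{opt}}(x)=\begin{cases}1,& x<a_1\\ 0,& a_1<x<a_2\\ 1,& a_2<x<a_3\\ 0,& x>a_3.\end{cases}$$ Moreover $a_1,a_2,a_3$ are finite unless $p_{\mathrm{opt}}$ is one of the designs $p_{\max}$ or $p_{\min}$. Here $p_{\max}$ (resp. $p_{\min}$) is a feasible design function that maximizes (resp. minimizes) $\mathbb{E}_p(x^2z)$ over all feasible design functions and that has the form $$p_{\max}(x)=\begin{cases}1,& x\notin[b_1,b_2]\\ 0,& x\in(b_1,b_2)\end{cases}\qquad\Bigl(\text{resp. } p_{\min}(x)=\begin{cases}1,& x\in(b_1,b_2)\\ 0,& x\notin[b_1,b_2]\end{cases}\Bigr)$$ for some $b_1\le b_2$ in $[-\infty,\infty]$, which are finite if $\widetilde{xz}<\widetilde{xz}_{\max}(\widetilde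 z)$. -/

import Mathlib

open MeasureTheory

namespace TieBreaker

noncomputable section

/-- The standing assumption on the law `F` of the running variable `x`:
finite second moment, mean zero, and positive variance. -/
structure IsRunningLaw (F : Measure ℝ) : Prop where
  memLp_two : MemLp (fun x : ℝ => x) 2 F
  mean_zero : ∫ x, x ∂F = 0
  var_pos : 0 < ProbabilityTheory.variance (fun x : ℝ => x) F

/-- A design function: a measurable function from `ℝ` to `[0, 1]`;
`p x` is the conditional probability of treatment (`z = 1`) given the running variable `x`. -/
def IsDesign (p : ℝ → ℝ) : Prop :=
  Measurable p ∧ ∀ x, p x ∈ Set.Icc (0 : ℝ) 1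

/-- The expectation `E_p (g (x, z))`, where `x` has law `F` and, given `x`, the treatment
indicator `z ∈ {-1, 1}` equals `1` with probability `p x` and `-1` with probability `1 - p x`. -/
def designExp (F : Measure ℝ) (p : ℝ → ℝ) (g : ℝ → ℝ → ℝ) : ℝ :=
  ∫ x, (p x * g x 1 + (1 - p x) * g x (-1)) ∂F

/-- The treatment balance `E_p (z)`. -/
def meanZ (F : Measure ℝ) (p : ℝ → ℝ) : ℝ := designExp F p fun _ z => z

/-- The short-term gain `E_p (x z)`. -/
def meanXZ (F : Measure ℝ) (p : ℝ → ℝ) : ℝ := designExp F p fun x z => x * z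

/-- The moment `E_p (x² z)`. -/
def meanXXZ (F : Measure ℝ) (p : ℝ → ℝ) : ℝ := designExp F p fun x z => x ^ 2 * z

/-- The regressors `(1, x, z, x z)` of the two-line model
`y = β₀ + β₁ x + β₂ z + β₃ x z + ε`. -/
def regressor (x z : ℝ) : Fin 4 → ℝ := ![1, x, z, x * z]

/-- The expected information matrix of the design `p` in the two-line model with error
standard deviation `σ`: the matrix with entries `σ⁻² E_p (X i * X j)`, `X = (1, x, z, x z)`. -/
def infoMatrix (F : Measure ℝ) (σ : ℝ) (p : ℝ → ℝ) : Matrix (Fin 4) (Fin 4) ℝ :=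
  Matrix.of fun i j => (σ ^ 2)⁻¹ * designExp F p fun x z => regressor x z i * regressor x z j

/-- The largest short-term gain of a design function with treatment balance `zt`
(a nonempty bounded set of reals when `-1 < zt < 1`). -/
def maxGain (F : Measure ℝ) (zt : ℝ) : ℝ :=
  sSup (meanXZ F '' {p | IsDesign p ∧ meanZ F p = zt})

/-- The feasible input space. -/
def inputSpace (F : Measure ℝ) : Set (ℝ × ℝ) :=
  {c | -1 < c.1 ∧ c.1 < 1 ∧ 0 ≤ c.2 ∧ c.2 ≤ maxGain F c.1}

/-- The input-feasible design functions. -/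
def inputFeasible (F : Measure ℝ) : Set (ℝ → ℝ) :=
  {p | IsDesign p ∧ (meanZ F p, meanXZ F p) ∈ inputSpace F}

/-- The feasible design functions for the constraints `E_p (z) = zt` and `E_p (x z) = xzt`. -/
def feasible (F : Measure ℝ) (zt xzt : ℝ) : Set (ℝ → ℝ) :=
  {p | IsDesign p ∧ meanZ F p = zt ∧ meanXZ F p = xzt}

/-- `p` maximizes the efficiency criterion `Ψ` of the information matrix
over all feasible design functions. -/
def IsOptimalDesign (F : Measure ℝ) (σ : ℝ) (Ψ : Matrix (Fin 4) (Fin 4) ℝ → EReal)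
    (zt xzt : ℝ) (p : ℝ → ℝ) : Prop :=
  p ∈ feasible F zt xzt ∧
    ∀ q ∈ feasible F zt xzt, Ψ (infoMatrix F σ q) ≤ Ψ (infoMatrix F σ p)

/-- The extended real number `a` is finite. -/
def IsFinite (a : EReal) : Prop := a ≠ ⊥ ∧ a ≠ ⊤

/-- The design `p_max`: it maximizes `E_p (x² z)` over the feasible designs, and it is `1` outside
`[a₁, a₂]` and `0` on `(a₁, a₂)`, where `a₁ ≤ a₂` may be infinite only if the short-term gain
is maximal. -/
def IsPMax (F : Measure ℝ) (zt xzt : ℝ) (p : ℝ → ℝ) : Prop :=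
  (p ∈ feasible F zt xzt ∧ ∀ q ∈ feasible F zt xzt, meanXXZ F q ≤ meanXXZ F p) ∧
    ∃ a₁ a₂ : EReal, a₁ ≤ a₂ ∧
      (∀ x : ℝ, (x : EReal) ∉ Set.Icc a₁ a₂ → p x = 1) ∧
      (∀ x : ℝ, (x : EReal) ∈ Set.Ioo a₁ a₂ → p x = 0) ∧
      ((IsFinite a₁ ∧ IsFinite a₂) ∨ xzt = maxGain F zt)

/-- The design `p_min`: it minimizes `E_p (x² z)` over the feasible designs, and it is `1` on
`(b₁, b₂)` and `0` outside `[b₁, b₂]`, where `b₁ ≤ b₂` may be infinite only if the short-term gain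
is maximal. -/
def IsPMin (F : Measure ℝ) (zt xzt : ℝ) (p : ℝ → ℝ) : Prop :=
  (p ∈ feasible F zt xzt ∧ ∀ q ∈ feasible F zt xzt, meanXXZ F p ≤ meanXXZ F q) ∧
    ∃ b₁ b₂ : EReal, b₁ ≤ b₂ ∧
      (∀ x : ℝ, (x : EReal) ∈ Set.Ioo b₁ b₂ → p x = 1) ∧
      (∀ x : ℝ, (x : EReal) ∉ Set.Icc b₁ b₂ → p x = 0) ∧
      ((IsFinite b₁ ∧ IsFinite b₂) ∨ xzt = maxGain F zt)

/-- `p` equals `1` below `a₁`, `0` on `(a₁, a₂)`, `1` on `(a₂, a₃)` and `0` above `a₃`. -/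
def HasFourPieces (p : ℝ → ℝ) (a₁ a₂ a₃ : EReal) : Prop :=
  ∀ x : ℝ,
    ((x : EReal) < a₁ → p x = 1) ∧
    (a₁ < (x : EReal) → (x : EReal) < a₂ → p x = 0) ∧
    (a₂ < (x : EReal) → (x : EReal) < a₃ → p x = 1) ∧
    (a₃ < (x : EReal) → p x = 0)

end

end TieBreaker

/-! # Optimal tie-breaker designs

The information matrix of a design `p` is an affine function of the moments `∫ p x * x ^ i`,
`i ≤ 2`, and the feasibility constraints fix the first two of them. The set of moment vectors with
`i ≤ 3` is convex, and it is compact (`isCompact_momentSet`, from the Banach-Alaoglu theorem in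
`L²`), so a continuous criterion attains its maximum over the feasible moments
(`exists_isMaxOn_feasibleMoments`).

It remains to realize the optimal moments by a design of the required shape. Among the designs with
the optimal moments of order at most two, take one that minimizes the third moment. Its moment
vector is then supported from below by a nonzero functional `c` with `0 ≤ c 3`
(`exists_multipliers`), which says that the design minimizes `∫ p * P` over all designs, where
`P x = ∑ i, c i * x ^ i`. Hence, after a change on a null set, it equals `1` where `P < 0` and `0`
where `P > 0` (`exists_design_of_cubic_sign`).

If `c 3 > 0`, the sign pattern of the cubic `P` gives the four pieces, with finite endpoints
(`hasFourPieces_of_cubic`). If `P` is quadratic, the support inequality says that the design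
extremizes `E_p (x² z)`, so that it is `p_max` or `p_min` (`isPMin_or_isPMax_of_quadratic`). If `P`
has degree at most one, nonnegativity of the short-term gain and nondegeneracy of `F` force `P` to
be strictly decreasing, so that the design is a threshold design of maximal gain; such designs agree
almost everywhere off the threshold, and the design is `p_max` (`isPMax_of_linear`).
-/

open scoped Pointwise

namespace TieBreaker

/-! ### Compactness of the moment set -/

section Moments

variable {α ι : Type*} [MeasurableSpace α]

/-- The moment set: all vectors of integrals of the functions `g i` against a measurable weight
with values in `[0, 1]`. -/
def momentSet (μ : Measure α) (g : ι → α → ℝ) : Set (ι → ℝ) :=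
  {m | ∃ p : α → ℝ, (Measurable p ∧ ∀ x, p x ∈ Set.Icc (0 : ℝ) 1) ∧
    ∀ i, m i = ∫ x, p x * g i x ∂μ}

lemma integrable_weight_mul {μ : Measure α} {p f : α → ℝ}
    (hp : Measurable p ∧ ∀ x, p x ∈ Set.Icc (0 : ℝ) 1) (hf : Integrable f μ) :
    Integrable (fun x => p x * f x) μ := by
  refine hf.bdd_mul (c := 1) hp.1.aestronglyMeasurable (Filter.Eventually.of_forall fun x => ?_)
  rw [Real.norm_eq_abs, abs_of_nonneg (hp.2 x).1]
  exact (hp.2 x).2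

lemma convex_momentSet {μ : Measure α} {g : ι → α → ℝ} (hg : ∀ i, Integrable (g i) μ) :
    Convex ℝ (momentSet μ g) := by
  rintro _ ⟨p, hp, hm⟩ _ ⟨q, hq, hn⟩ a b ha hb hab
  refine ⟨fun x => a * p x + b * q x, ⟨(hp.1.const_mul a).add (hq.1.const_mul b), fun x =>
    convex_Icc (0 : ℝ) 1 (hp.2 x) (hq.2 x) ha hb hab⟩, fun i => ?_⟩
  have h1 := (integrable_weight_mul hp (hg i)).const_mul a
  have h2 := (integrable_weight_mul hq (hg i)).const_mul b
  simp only [Pi.add_apply, Pi.smul_apply, smul_eq_mul, hm, hn, ← integral_const_mul]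
  rw [← integral_add h1 h2]
  exact integral_congr_ae (Filter.Eventually.of_forall fun x => by simp only []; ring)

/-- The moment set is compact. The weights `p` are encoded as the functions `f = p * w` of `L²`,
where `w = √(1 + ∑ i, |g i|)`. They fill the set `0 ≤ f ≤ w`, which is weak-* compact by
Banach-Alaoglu, and the `i`-th moment is the inner product of `f` with `g i / w`, which lies in
`L²`. -/
theorem isCompact_momentSet [Fintype ι] (μ : Measure α) [IsFiniteMeasure μ] (g : ι → α → ℝ)
    (hgm : ∀ i, Measurable (g i)) (hg : ∀ i, Integrable (g i) μ) :
    IsCompact (momentSet μ g) := by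
  set v : α → ℝ := fun x => 1 + ∑ i, |g i x| with hv
  have hv1 : ∀ x, 1 ≤ v x := fun x =>
    le_add_of_nonneg_right (Finset.sum_nonneg fun i _ => abs_nonneg _)
  have hvi : ∀ i x, |g i x| ≤ v x := fun i x => by
    have := Finset.single_le_sum (f := fun i => |g i x|) (fun i _ => abs_nonneg _)
      (Finset.mem_univ i)
    simp only [hv]; linarith
  have hvint : Integrable v μ :=
    (integrable_const 1).add (integrable_finsetSum _ fun i _ => (hg i).abs)
  have hvm : Measurable v :=
    measurable_const.add (Finset.measurable_sum _ fun i _ => (hgm i).abs)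
  set w : α → ℝ := fun x => Real.sqrt (v x) with hw
  have hwm : Measurable w := hvm.sqrt
  have hwpos : ∀ x, 0 < w x := fun x => Real.sqrt_pos.2 (by linarith [hv1 x])
  have hww : ∀ x, w x * w x = v x := fun x => Real.mul_self_sqrt (by linarith [hv1 x])
  have hwL : MemLp w 2 μ := by
    rw [memLp_two_iff_integrable_sq hwm.aestronglyMeasurable]
    exact hvint.congr (Filter.Eventually.of_forall fun x => by simp only [sq, hww])
  have hgL : ∀ i, MemLp (fun x => g i x / w x) 2 μ := fun i => by
    refine hwL.mono ((hgm i).div hwm).aestronglyMeasurable (Filter.Eventually.of_forall fun x => ?_)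
    rw [Real.norm_eq_abs, Real.norm_eq_abs, abs_div, abs_of_pos (hwpos x), div_le_iff₀ (hwpos x),
      hww]
    exact hvi i x
  let S : Set (WeakDual ℝ (Lp ℝ 2 μ)) :=
    (WeakDual.toStrongDual ⁻¹' Metric.closedBall 0 ‖hwL.toLp w‖) ∩
      {φ | ∀ A, ∀ hA : MeasurableSet A,
        φ (indicatorConstLp 2 hA (measure_ne_top μ A) 1) ∈ Set.Icc 0 (∫ x in A, w x ∂μ)}
  have hS : IsCompact S := by
    refine (WeakDual.isCompact_closedBall _ _).inter_right ?_
    simp only [Set.ofPred_forall]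
    exact isClosed_iInter fun A => isClosed_iInter fun hA =>
      isClosed_Icc.preimage (WeakDual.eval_continuous _)
  have himg : momentSet μ g = (fun φ : WeakDual ℝ (Lp ℝ 2 μ) =>
      fun i => φ ((hgL i).toLp _)) '' S := by
    ext m
    constructor
    · rintro ⟨p, hp, hm⟩
      have hpL : MemLp (fun x => p x * w x) 2 μ := by
        refine hwL.mono (hp.1.mul hwm).aestronglyMeasurable
          (Filter.Eventually.of_forall fun x => ?_)
        rw [norm_mul]
        refine mul_le_of_le_one_left (norm_nonneg _) ?_
        rw [Real.norm_eq_abs, abs_of_nonneg (hp.2 x).1]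
        exact (hp.2 x).2
      refine ⟨StrongDual.toWeakDual (InnerProductSpace.toDual ℝ _ (hpL.toLp _)), ⟨?_, ?_⟩, ?_⟩
      · have : ‖hpL.toLp _‖ ≤ ‖hwL.toLp w‖ := by
          refine Lp.norm_le_norm_of_ae_le ?_
          filter_upwards [hpL.coeFn_toLp, hwL.coeFn_toLp] with x h1 h2
          rw [h1, h2, norm_mul]
          refine mul_le_of_le_one_left (norm_nonneg _) ?_
          rw [Real.norm_eq_abs, abs_of_nonneg (hp.2 x).1]
          exact (hp.2 x).2
        simpa using this
      · intro A hA
        have : (StrongDual.toWeakDual (InnerProductSpace.toDual ℝ _ (hpL.toLp _)))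
            (indicatorConstLp 2 hA (measure_ne_top μ A) 1) = ∫ x in A, p x * w x ∂μ := by
          change inner ℝ (hpL.toLp _) _ = _
          rw [real_inner_comm, L2.inner_indicatorConstLp_one]
          exact integral_congr_ae (ae_restrict_of_ae hpL.coeFn_toLp)
        rw [this]
        refine ⟨integral_nonneg fun x => mul_nonneg (hp.2 x).1 (hwpos x).le, ?_⟩
        exact integral_mono (hpL.integrable one_le_two).integrableOn
          (hwL.integrable one_le_two).integrableOn
          fun x => mul_le_of_le_one_left (hwpos x).le (hp.2 x).2
      · funext i
        change inner ℝ (hpL.toLp _) _ = _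
        rw [hm, L2.inner_def]
        refine integral_congr_ae ?_
        filter_upwards [hpL.coeFn_toLp, (hgL i).coeFn_toLp] with x h1 h2
        rw [h1, h2]
        have := (hwpos x).ne'
        simp only [RCLike.inner_apply, conj_trivial]
        field_simp
    · rintro ⟨φ, ⟨-, hφ⟩, rfl⟩
      set f := (InnerProductSpace.toDual ℝ (Lp ℝ 2 μ)).symm (WeakDual.toStrongDual φ) with hf
      have hφf : ∀ u, φ u = inner ℝ f u := fun u =>
        (InnerProductSpace.toDual_symm_apply (𝕜 := ℝ) (y := WeakDual.toStrongDual φ) (x := u)).symm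
      have hset : ∀ A, MeasurableSet A → ∫ x in A, f x ∂μ ∈ Set.Icc 0 (∫ x in A, w x ∂μ) := by
        intro A hA
        have := hφ A hA
        rwa [hφf, real_inner_comm, L2.inner_indicatorConstLp_one] at this
      have hfi : Integrable f μ := (Lp.memLp f).integrable one_le_two
      have hf0 : 0 ≤ᵐ[μ] f :=
        ae_nonneg_of_forall_setIntegral_nonneg hfi fun A hA _ => (hset A hA).1
      have hfw : f ≤ᵐ[μ] w :=
        ae_le_of_forall_setIntegral_le hfi (hwL.integrable one_le_two) fun A hA _ => (hset A hA).2
      refine ⟨fun x => max 0 (min 1 (f x / w x)), ⟨measurable_const.max (measurable_const.min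
        ((Lp.stronglyMeasurable f).measurable.div hwm)), fun x =>
          ⟨le_max_left _ _, max_le zero_le_one (min_le_left _ _)⟩⟩, fun i => ?_⟩
      simp only [hφf]
      rw [L2.inner_def]
      refine integral_congr_ae ?_
      filter_upwards [hf0, hfw, (hgL i).coeFn_toLp] with x h0 h1 h2
      have h3 : 0 ≤ f x / w x := div_nonneg h0 (hwpos x).le
      have h4 : f x / w x ≤ 1 := (div_le_one (hwpos x)).2 h1
      rw [h2, min_eq_right h4, max_eq_right h3]
      simp only [RCLike.inner_apply, conj_trivial]
      ring
  rw [himg]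
  exact hS.image (continuous_pi fun i => WeakDual.eval_continuous _)

end Moments

/-! ### Lagrange multipliers -/

lemma exists_support_functional {E : Type*} [NormedAddCommGroup E] [NormedSpace ℝ E]
    [FiniteDimensional ℝ E] {s : Set E} (hs : Convex ℝ s) {x : E} (hxs : x ∈ s)
    (hx : x ∉ interior s) :
    ∃ f : StrongDual ℝ E, f ≠ 0 ∧ ∀ a ∈ s, f x ≤ f a := by
  by_cases hne : (interior s).Nonempty
  · obtain ⟨f, hf, h⟩ := geometric_hahn_banach_of_nonempty_interior_point hs hx hne
    exact ⟨-f, neg_ne_zero.2 hf, fun a ha => by simpa using h a ha⟩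
  · have hspan : (affineSpan ℝ s).direction < ⊤ := by
      rw [lt_top_iff_ne_top]
      intro htop
      refine hne ((hs.interior_nonempty_iff_affineSpan_eq_top).2 ?_)
      exact (AffineSubspace.direction_eq_top_iff_of_nonempty
        ⟨x, subset_affineSpan ℝ s hxs⟩).1 htop
    obtain ⟨f, hf, hker⟩ := Submodule.exists_le_ker_of_lt_top _ hspan
    refine ⟨LinearMap.toContinuousLinearMap f, by simpa using hf, fun a ha => ?_⟩
    have : f (a - x) = 0 := LinearMap.mem_ker.1 (hker (AffineSubspace.vsub_mem_direction
      (subset_affineSpan ℝ s ha) (subset_affineSpan ℝ s hxs)))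
    rw [map_sub, sub_eq_zero] at this
    exact this.ge

/-- Fritz John multipliers for minimizing the `j`-th coordinate over a convex set with the other
coordinates fixed. No constraint qualification is assumed, so `c j` may vanish. -/
lemma exists_multipliers {ι : Type*} [Fintype ι] {K : Set (ι → ℝ)} (hK : Convex ℝ K) {m : ι → ℝ}
    (hm : m ∈ K) (j : ι) (hmin : ∀ k ∈ K, (∀ i, i ≠ j → k i = m i) → m j ≤ k j) :
    ∃ c : ι → ℝ, c ≠ 0 ∧ 0 ≤ c j ∧ ∀ k ∈ K, ∑ i, c i * m i ≤ ∑ i, c i * k i := by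
  classical
  -- The set `K` is enlarged upwards in direction `j`, which forces `0 ≤ c j`.
  set R : Set (ι → ℝ) := (fun t : ℝ => Pi.single j t) '' Set.Ici 0
  have hR : Convex ℝ R := (convex_Ici (0 : ℝ)).linear_image (LinearMap.single ℝ (fun _ => ℝ) j)
  have hsub : ∀ k ∈ K, k ∈ K + R := fun k hk =>
    ⟨k, hk, 0, ⟨0, Set.mem_Ici.2 le_rfl, by simp⟩, by simp⟩
  have hint : m ∉ interior (K + R) := by
    intro h
    have hcont : Continuous fun t : ℝ => m + Pi.single j t :=
      continuous_const.add
        (ContinuousLinearMap.single ℝ (fun _ : ι => ℝ) j).continuous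
    have hnhds : ∀ᶠ t in nhds (0 : ℝ), m + Pi.single j t ∈ K + R := by
      refine hcont.tendsto 0 ?_
      simpa using mem_interior_iff_mem_nhds.1 h
    obtain ⟨ε, hε, hball⟩ := Metric.eventually_nhds_iff.1 hnhds
    have hm' : m + Pi.single j (-(ε / 2)) ∈ K + R := hball (by
      rw [Real.dist_eq, sub_zero, abs_neg, abs_of_pos (half_pos hε)]; linarith)
    obtain ⟨k, hk, _, ⟨t, ht, rfl⟩, hkt⟩ := hm'
    have hco : ∀ i, k i + (Pi.single j t : ι → ℝ) i = m i + (Pi.single j (-(ε / 2)) : ι → ℝ) i :=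
      fun i => congrFun hkt i
    have h1 := hmin k hk fun i hi => by simpa [hi] using hco i
    have h2 := hco j
    simp only [Pi.single_eq_same] at h2
    have : (0 : ℝ) ≤ t := ht
    linarith
  obtain ⟨f, hf, hsupp⟩ := exists_support_functional (hK.add hR) (hsub m hm) hint
  have hfsum : ∀ k : ι → ℝ, f k = ∑ i, f (Pi.single i 1) * k i := fun k => by
    rw [← ContinuousLinearMap.coe_coe, LinearMap.pi_apply_eq_sum_univ _ k]
    refine Finset.sum_congr rfl fun i _ => ?_
    rw [smul_eq_mul, mul_comm]
    congr 2
    funext l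
    simp [Pi.single_apply, eq_comm]
  refine ⟨fun i => f (Pi.single i 1), fun h0 => hf ?_, ?_, fun k hk => ?_⟩
  · ext k
    rw [hfsum]
    exact Finset.sum_eq_zero fun i _ => by rw [congrFun h0 i]; simp
  · have := hsupp (m + Pi.single j 1) ⟨m, hm, _, ⟨1, by simp, rfl⟩, rfl⟩
    rw [map_add] at this
    linarith
  · rw [← hfsum, ← hfsum]
    exact hsupp k (hsub k hk)

/-! ### Sign patterns of quadratic and cubic polynomials -/

lemma quadratic_factor_or_pos (u v : ℝ) :
    (∃ s t : ℝ, s ≤ t ∧ ∀ x : ℝ, x ^ 2 + u * x + v = (x - s) * (x - t)) ∨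
      ∀ x : ℝ, 0 < x ^ 2 + u * x + v := by
  rcases le_or_gt 0 (u ^ 2 - 4 * v) with h | h
  · left
    have hsq := Real.sq_sqrt h
    refine ⟨(-u - √(u ^ 2 - 4 * v)) / 2, (-u + √(u ^ 2 - 4 * v)) / 2, ?_, fun x => ?_⟩
    · linarith [Real.sqrt_nonneg (u ^ 2 - 4 * v)]
    · linear_combination (1 / 4) * hsq
  · right
    intro x
    nlinarith [sq_nonneg (2 * x + u)]

/-- The sign pattern of a product of three linear factors with ordered roots `a₁ ≤ a₂ ≤ a₃`. -/
def CubicSigns (P : ℝ → ℝ) (a₁ a₂ a₃ : ℝ) : Prop :=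
  ∀ x, (x < a₁ → P x < 0) ∧ (a₁ < x → x < a₂ → 0 < P x) ∧ (a₂ < x → x < a₃ → P x < 0) ∧
    (a₃ < x → 0 < P x)

lemma cubicSigns_of_le {r s t : ℝ} (hrs : r ≤ s) (hst : s ≤ t) :
    CubicSigns (fun x => (x - r) * (x - s) * (x - t)) r s t := by
  intro x
  refine ⟨fun h => ?_, fun h h' => ?_, fun h h' => ?_, fun h => ?_⟩
  · exact mul_neg_of_pos_of_neg (mul_pos_of_neg_of_neg (by linarith) (by linarith)) (by linarith)
  · exact mul_pos_of_neg_of_neg (mul_neg_of_pos_of_neg (by linarith) (by linarith)) (by linarith)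
  · exact mul_neg_of_pos_of_neg (mul_pos (by linarith) (by linarith)) (by linarith)
  · exact mul_pos (mul_pos (by linarith) (by linarith)) (by linarith)

lemma exists_root_monic_cubic (a b c : ℝ) : ∃ r : ℝ, r ^ 3 + a * r ^ 2 + b * r + c = 0 := by
  have hcont : Continuous fun x : ℝ => x ^ 3 + a * x ^ 2 + b * x + c := by fun_prop
  -- At `x = ± M` the leading term dominates, because `M ^ 3 = (1 + |a| + |b| + |c|) * M ^ 2`.
  set M := 1 + |a| + |b| + |c|
  have hM : 1 ≤ M := by
    have := abs_nonneg a; have := abs_nonneg b; have := abs_nonneg c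
    simp only [M]; linarith
  have hM2 : M ≤ M ^ 2 := by nlinarith
  have hM3 : M ^ 3 = M ^ 2 + |a| * M ^ 2 + |b| * M ^ 2 + |c| * M ^ 2 := by
    simp only [M]; ring
  have hb : |b| * M ≤ |b| * M ^ 2 := mul_le_mul_of_nonneg_left hM2 (abs_nonneg b)
  have hc : |c| * 1 ≤ |c| * M ^ 2 := mul_le_mul_of_nonneg_left (hM.trans hM2) (abs_nonneg c)
  have ha1 := mul_le_mul_of_nonneg_right (neg_abs_le a) (sq_nonneg M)
  have ha2 := mul_le_mul_of_nonneg_right (le_abs_self a) (sq_nonneg M)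
  have hb1 := mul_le_mul_of_nonneg_right (neg_abs_le b) (zero_le_one.trans hM)
  have hc1 := neg_abs_le c
  have hc2 := le_abs_self c
  have hM0 := sq_nonneg M
  obtain ⟨r, hr⟩ := mem_range_of_exists_le_of_exists_ge (c := (0 : ℝ)) hcont
    ⟨-M, by nlinarith⟩ ⟨M, by nlinarith⟩
  exact ⟨r, hr⟩

lemma exists_cubicSigns (a b c : ℝ) :
    ∃ a₁ a₂ a₃ : ℝ, a₁ ≤ a₂ ∧ a₂ ≤ a₃ ∧
      CubicSigns (fun x => x ^ 3 + a * x ^ 2 + b * x + c) a₁ a₂ a₃ := by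
  obtain ⟨r, hr⟩ := exists_root_monic_cubic a b c
  have hfac : ∀ x : ℝ, x ^ 3 + a * x ^ 2 + b * x + c =
      (x - r) * (x ^ 2 + (a + r) * x + (b + a * r + r ^ 2)) := fun x => by
    linear_combination hr
  rcases quadratic_factor_or_pos (a + r) (b + a * r + r ^ 2) with ⟨s, t, hst, hq⟩ | hq
  · have hfac' : ∀ x : ℝ, x ^ 3 + a * x ^ 2 + b * x + c = (x - r) * (x - s) * (x - t) :=
      fun x => by rw [hfac, hq]; ring
    rcases le_total r s with h | h
    · exact ⟨r, s, t, h, hst, by simpa only [hfac'] using cubicSigns_of_le h hst⟩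
    rcases le_total r t with h' | h'
    · refine ⟨s, r, t, h, h', ?_⟩
      have := cubicSigns_of_le h h'
      simpa only [hfac', mul_comm (_ - r) (_ - s)] using this
    · refine ⟨s, t, r, hst, h', ?_⟩
      have := cubicSigns_of_le hst h'
      simpa only [hfac', mul_assoc, mul_comm (_ - r)] using this
  · refine ⟨r, r, r, le_rfl, le_rfl, fun x => ?_⟩
    simp only [hfac]
    refine ⟨fun h => mul_neg_of_neg_of_pos (by linarith) (hq x), fun h h' => ?_, fun h h' => ?_,
      fun h => mul_pos (by linarith) (hq x)⟩ <;> linarith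

/-! ### Power moments of design functions -/

/-- The moments `∫ p x * x ^ i` for `i = 0, 1, 2, 3`. -/
noncomputable def powerMoments (F : Measure ℝ) (p : ℝ → ℝ) (i : Fin 4) : ℝ :=
  ∫ x, p x * x ^ (i : ℕ) ∂F

lemma integrable_pow_of_le_three {F : Measure ℝ} [IsFiniteMeasure F]
    (h3 : Integrable (fun x : ℝ => |x| ^ 3) F) {n : ℕ} (hn : n ≤ 3) :
    Integrable (fun x : ℝ => x ^ n) F := by
  refine ((integrable_const (1 : ℝ)).add h3).mono' (by fun_prop)
    (Filter.Eventually.of_forall fun x => ?_)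
  rw [Real.norm_eq_abs, abs_pow, Pi.add_apply]
  rcases le_total |x| 1 with h | h
  · linarith [pow_le_one₀ (n := n) (abs_nonneg x) h, pow_nonneg (abs_nonneg x) 3]
  · linarith [pow_le_pow_right₀ h hn]

lemma designExp_monomial {F : Measure ℝ} [IsFiniteMeasure F]
    (h3 : Integrable (fun x : ℝ => |x| ^ 3) F) {p : ℝ → ℝ} (hp : IsDesign p) {n : ℕ} (hn : n ≤ 3)
    (k : ℕ) :
    designExp F p (fun x z => x ^ n * z ^ k) =
      (-1) ^ k * ∫ x, x ^ n ∂F + (1 - (-1) ^ k) * ∫ x, p x * x ^ n ∂F := by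
  have hi := integrable_pow_of_le_three h3 hn
  rw [← integral_const_mul, ← integral_const_mul,
    ← integral_add (hi.const_mul _) ((integrable_weight_mul hp hi).const_mul _)]
  refine integral_congr_ae (Filter.Eventually.of_forall fun x => ?_)
  simp only [one_pow]
  ring

variable {F : Measure ℝ}

lemma meanZ_eq [IsProbabilityMeasure F]
    (h3 : Integrable (fun x : ℝ => |x| ^ 3) F) {p : ℝ → ℝ} (hp : IsDesign p) :
    meanZ F p = 2 * powerMoments F p 0 - 1 := by
  have := designExp_monomial h3 hp (n := 0) (by norm_num) 1
  simp only [pow_zero, one_mul, pow_one, integral_const, probReal_univ, smul_eq_mul] at this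
  simp only [meanZ, powerMoments, this, Fin.val_zero, pow_zero]
  ring

lemma meanXZ_eq [IsProbabilityMeasure F] (hF : IsRunningLaw F)
    (h3 : Integrable (fun x : ℝ => |x| ^ 3) F) {p : ℝ → ℝ}
    (hp : IsDesign p) : meanXZ F p = 2 * powerMoments F p 1 := by
  have := designExp_monomial h3 hp (n := 1) (by norm_num) 1
  simp only [pow_one, hF.mean_zero] at this
  simp only [meanXZ, powerMoments, this, Fin.val_one, pow_one]
  ring

lemma meanXXZ_eq [IsProbabilityMeasure F]
    (h3 : Integrable (fun x : ℝ => |x| ^ 3) F) {p : ℝ → ℝ} (hp : IsDesign p) :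
    meanXXZ F p = 2 * powerMoments F p 2 - ∫ x, x ^ 2 ∂F := by
  have := designExp_monomial h3 hp (n := 2) (by norm_num) 1
  simp only [pow_one] at this
  simp only [meanXXZ, powerMoments, this, Fin.val_two]
  ring

lemma powerMoments_const_zero [IsProbabilityMeasure F] (m : ℝ) :
    powerMoments F (fun _ => m) 0 = m := by
  simp [powerMoments]

lemma powerMoments_const_one (hF : IsRunningLaw F) (m : ℝ) :
    powerMoments F (fun _ => m) 1 = 0 := by
  simp only [powerMoments, Fin.val_one, pow_one]
  exact (integral_const_mul m fun x : ℝ => x).trans (by rw [hF.mean_zero, mul_zero])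

lemma integral_weight_mul_poly [IsFiniteMeasure F]
    (h3 : Integrable (fun x : ℝ => |x| ^ 3) F) {p : ℝ → ℝ}
    (hp : IsDesign p) (c : Fin 4 → ℝ) :
    ∫ x, p x * ∑ i, c i * x ^ (i : ℕ) ∂F = ∑ i, c i * powerMoments F p i := by
  simp only [powerMoments, ← integral_const_mul]
  rw [← integral_finsetSum]
  · refine integral_congr_ae (Filter.Eventually.of_forall fun x => ?_)
    simp only [Finset.mul_sum]
    exact Finset.sum_congr rfl fun i _ => by ring
  · exact fun i _ => (integrable_weight_mul hp
      (integrable_pow_of_le_three h3 (by omega))).const_mul _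

lemma integrable_poly [IsFiniteMeasure F]
    (h3 : Integrable (fun x : ℝ => |x| ^ 3) F) (c : Fin 4 → ℝ) :
    Integrable (fun x : ℝ => ∑ i, c i * x ^ (i : ℕ)) F :=
  integrable_finsetSum _ fun i _ => (integrable_pow_of_le_three h3 (by omega)).const_mul _

/-- The set of power moments of design functions. -/
noncomputable def designMoments (F : Measure ℝ) : Set (Fin 4 → ℝ) :=
  momentSet F fun i x => x ^ (i : ℕ)

lemma mem_designMoments {m : Fin 4 → ℝ} :
    m ∈ designMoments F ↔ ∃ p, IsDesign p ∧ m = powerMoments F p := by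
  simp only [designMoments, momentSet, IsDesign, powerMoments, funext_iff, Set.mem_ofPred_eq]

lemma isCompact_designMoments [IsFiniteMeasure F] (h3 : Integrable (fun x : ℝ => |x| ^ 3) F) :
    IsCompact (designMoments F) :=
  isCompact_momentSet F _ (fun _ => by fun_prop)
    fun i => integrable_pow_of_le_three h3 (by omega)

lemma convex_designMoments [IsFiniteMeasure F] (h3 : Integrable (fun x : ℝ => |x| ^ 3) F) :
    Convex ℝ (designMoments F) :=
  convex_momentSet fun i => integrable_pow_of_le_three h3 (by omega)

/-- The information matrix as a function of the power moments of the design. The `i`-th regressor is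
`x ^ (i % 2) * z ^ (i / 2)`, so only the first three moments enter. -/
noncomputable def infoOfMoments (F : Measure ℝ) (σ : ℝ) (m : Fin 4 → ℝ) :
    Matrix (Fin 4) (Fin 4) ℝ :=
  Matrix.of fun i j => (σ ^ 2)⁻¹ *
    ((-1) ^ (i / 2 + j / 2 : ℕ) * ∫ x, x ^ (i % 2 + j % 2 : ℕ) ∂F +
      (1 - (-1) ^ (i / 2 + j / 2 : ℕ)) * m ⟨i % 2 + j % 2, by omega⟩)

lemma continuous_infoOfMoments (σ : ℝ) : Continuous (infoOfMoments F σ) :=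
  continuous_matrix fun i j => by
    simp only [infoOfMoments, Matrix.of_apply]
    fun_prop

lemma regressor_eq (x z : ℝ) (i : Fin 4) :
    regressor x z i = x ^ (i % 2 : ℕ) * z ^ (i / 2 : ℕ) := by
  fin_cases i <;> simp [regressor]

lemma infoMatrix_eq [IsFiniteMeasure F]
    (h3 : Integrable (fun x : ℝ => |x| ^ 3) F) (σ : ℝ) {p : ℝ → ℝ}
    (hp : IsDesign p) : infoMatrix F σ p = infoOfMoments F σ (powerMoments F p) := by
  ext i j
  have hfun : (fun x z : ℝ => regressor x z i * regressor x z j) =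
      fun x z => x ^ (i % 2 + j % 2 : ℕ) * z ^ (i / 2 + j / 2 : ℕ) := by
    funext x z
    rw [regressor_eq, regressor_eq, pow_add, pow_add]
    ring
  simp only [infoMatrix, infoOfMoments, Matrix.of_apply, hfun]
  rw [designExp_monomial h3 hp (by omega)]
  rfl

lemma infoOfMoments_congr (σ : ℝ) {m n : Fin 4 → ℝ} (h : ∀ i, i ≠ 3 → n i = m i) :
    infoOfMoments F σ n = infoOfMoments F σ m := by
  ext i j
  simp only [infoOfMoments, Matrix.of_apply]
  rw [h ⟨i % 2 + j % 2, by omega⟩ (by simp [Fin.ext_iff]; omega)]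

/-! ### Feasibility and optimal moments -/

/-- The moments of the feasible designs. -/
def feasibleMoments (F : Measure ℝ) (zt xzt : ℝ) : Set (Fin 4 → ℝ) :=
  designMoments F ∩ {m | 2 * m 0 - 1 = zt ∧ 2 * m 1 = xzt}

lemma mem_feasible_iff [IsProbabilityMeasure F] (hF : IsRunningLaw F)
    (h3 : Integrable (fun x : ℝ => |x| ^ 3) F)
    {zt xzt : ℝ} {p : ℝ → ℝ} :
    p ∈ feasible F zt xzt ↔
      IsDesign p ∧ 2 * powerMoments F p 0 - 1 = zt ∧ 2 * powerMoments F p 1 = xzt := by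
  refine and_congr_right fun hp => ?_
  rw [meanZ_eq h3 hp, meanXZ_eq hF h3 hp]

lemma mem_feasibleMoments_iff [IsProbabilityMeasure F] (hF : IsRunningLaw F)
    (h3 : Integrable (fun x : ℝ => |x| ^ 3) F)
    {zt xzt : ℝ} {m : Fin 4 → ℝ} :
    m ∈ feasibleMoments F zt xzt ↔ ∃ p ∈ feasible F zt xzt, m = powerMoments F p := by
  simp only [feasibleMoments, Set.mem_inter_iff, mem_designMoments, mem_feasible_iff hF h3,
    Set.mem_ofPred_eq]
  constructor
  · rintro ⟨⟨p, hp, rfl⟩, h⟩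
    exact ⟨p, ⟨hp, h⟩, rfl⟩
  · rintro ⟨p, ⟨hp, h⟩, rfl⟩
    exact ⟨⟨p, hp, rfl⟩, h⟩

lemma isCompact_feasibleMoments [IsFiniteMeasure F]
    (h3 : Integrable (fun x : ℝ => |x| ^ 3) F) (zt xzt : ℝ) :
    IsCompact (feasibleMoments F zt xzt) :=
  (isCompact_designMoments h3).inter_right
    ((isClosed_eq (by fun_prop) continuous_const).inter
      (isClosed_eq (by fun_prop) continuous_const))

lemma isDesign_const {m : ℝ} (h0 : 0 ≤ m) (h1 : m ≤ 1) : IsDesign fun _ => m :=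
  ⟨measurable_const, fun _ => ⟨h0, h1⟩⟩

lemma nonempty_feasibleMoments [IsProbabilityMeasure F] (hF : IsRunningLaw F)
    (h3 : Integrable (fun x : ℝ => |x| ^ 3) F)
    {zt xzt : ℝ} (hJ : (zt, xzt) ∈ inputSpace F) : (feasibleMoments F zt xzt).Nonempty := by
  obtain ⟨hz1, hz2, h0, hmax⟩ := hJ
  simp only at hz1 hz2 h0 hmax
  have hconst := isDesign_const (m := (zt + 1) / 2) (by linarith) (by linarith)
  set n := powerMoments F fun _ => (zt + 1) / 2
  have hn0 : n 0 = (zt + 1) / 2 := powerMoments_const_zero _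
  have hn1 : n 1 = 0 := powerMoments_const_one hF _
  have hnK : n ∈ designMoments F := mem_designMoments.2 ⟨_, hconst, rfl⟩
  -- The supremum defining `maxGain` is attained, by compactness.
  set T := designMoments F ∩ {m | 2 * m 0 - 1 = zt}
  have hT : IsCompact T :=
    (isCompact_designMoments h3).inter_right (isClosed_eq (by fun_prop) continuous_const)
  have hTn : n ∈ T := ⟨hnK, by simp only [Set.mem_ofPred_eq, hn0]; ring⟩
  have himg : meanXZ F '' {p | IsDesign p ∧ meanZ F p = zt} = (fun m => 2 * m 1) '' T := by
    ext y
    constructor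
    · rintro ⟨p, ⟨hp, hpz⟩, rfl⟩
      exact ⟨_, ⟨mem_designMoments.2 ⟨p, hp, rfl⟩, (meanZ_eq h3 hp).symm.trans hpz⟩,
        (meanXZ_eq hF h3 hp).symm⟩
    · rintro ⟨m, ⟨hm, hmz⟩, rfl⟩
      obtain ⟨p, hp, rfl⟩ := mem_designMoments.1 hm
      exact ⟨p, ⟨hp, (meanZ_eq h3 hp).trans hmz⟩, meanXZ_eq hF h3 hp⟩
  obtain ⟨m, ⟨hmK, hmz⟩, hm⟩ := hT.exists_sSup_image_eq ⟨n, hTn⟩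
    (f := fun m => 2 * m 1) (by fun_prop)
  rw [maxGain, himg, hm] at hmax
  simp only [Set.mem_ofPred_eq] at hmz
  -- A mixture of the gain-maximizing design and the constant design has the required gain.
  obtain ⟨r, hr0, hr1, hr⟩ : ∃ r : ℝ, 0 ≤ r ∧ r ≤ 1 ∧ r * (2 * m 1) = xzt := by
    rcases h0.eq_or_lt with h | h
    · exact ⟨0, le_rfl, zero_le_one, by rw [zero_mul, h]⟩
    · have hpos := h.trans_le hmax
      exact ⟨xzt / (2 * m 1), div_nonneg h0 hpos.le, (div_le_one hpos).2 hmax,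
        div_mul_cancel₀ _ hpos.ne'⟩
  refine ⟨r • m + (1 - r) • n, convex_designMoments h3 hmK hnK hr0 (by linarith) (by ring), ?_, ?_⟩
  · simp only [Pi.add_apply, Pi.smul_apply, smul_eq_mul, hn0]
    linear_combination r * hmz
  · simp only [Pi.add_apply, Pi.smul_apply, smul_eq_mul, hn1]
    linear_combination hr

/-! ### Minimizers of a linear functional of the design -/

/-- The bang-bang principle: a design minimizing `∫ p * P` treats where `P < 0` and does not treat
where `P > 0`. -/
lemma ae_eq_of_isMinimizer {P : ℝ → ℝ} (hPm : Measurable P) (hP : Integrable P F) {p : ℝ → ℝ}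
    (hp : IsDesign p) (hmin : ∀ q, IsDesign q → ∫ x, p x * P x ∂F ≤ ∫ x, q x * P x ∂F) :
    ∀ᵐ x ∂F, (P x < 0 → p x = 1) ∧ (0 < P x → p x = 0) := by
  set q : ℝ → ℝ := fun x => if P x < 0 then 1 else 0
  have hq : IsDesign q := by
    refine ⟨Measurable.ite (measurableSet_lt hPm measurable_const) measurable_const
      measurable_const, fun x => ?_⟩
    simp only [q]
    split_ifs <;> simp
  have hpi := integrable_weight_mul hp hP
  have hqi := integrable_weight_mul hq hP
  have hle : ∀ x, q x * P x ≤ p x * P x := fun x => by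
    obtain ⟨h0, h1⟩ := hp.2 x
    simp only [q]
    split_ifs with h
    · nlinarith
    · nlinarith
  have heq : (fun x => q x * P x) =ᵐ[F] fun x => p x * P x :=
    (integral_eq_iff_of_ae_le hqi hpi (Filter.Eventually.of_forall hle)).1
      (le_antisymm (integral_mono hqi hpi hle) (hmin q hq))
  filter_upwards [heq] with x hx
  refine ⟨fun h => ?_, fun h => ?_⟩
  · simpa [q, h] using (mul_right_cancel₀ h.ne hx).symm
  · simpa [q, h.not_gt] using (mul_right_cancel₀ h.ne' hx).symm

lemma exists_ae_eq_of_isMinimizer {P : ℝ → ℝ} (hPm : Measurable P) (hP : Integrable P F)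
    {p : ℝ → ℝ} (hp : IsDesign p)
    (hmin : ∀ q, IsDesign q → ∫ x, p x * P x ∂F ≤ ∫ x, q x * P x ∂F) :
    ∃ q, IsDesign q ∧ q =ᵐ[F] p ∧ (∀ x, P x < 0 → q x = 1) ∧ ∀ x, 0 < P x → q x = 0 := by
  refine ⟨fun x => if P x < 0 then 1 else if 0 < P x then 0 else p x, ⟨?_, fun x => ?_⟩, ?_,
    fun x h => by simp [h], fun x h => by simp [h, h.not_gt]⟩
  · exact Measurable.ite (measurableSet_lt hPm measurable_const) measurable_const
      (Measurable.ite (measurableSet_lt measurable_const hPm) measurable_const hp.1)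
  · dsimp only
    split_ifs
    · simp
    · simp
    · exact hp.2 x
  · filter_upwards [ae_eq_of_isMinimizer hPm hP hp hmin] with x hx
    split_ifs with h h'
    · exact (hx.1 h).symm
    · exact (hx.2 h').symm
    · rfl

lemma powerMoments_congr {p q : ℝ → ℝ} (h : p =ᵐ[F] q) : powerMoments F p = powerMoments F q := by
  funext i
  refine integral_congr_ae ?_
  filter_upwards [h] with x hx
  rw [hx]

lemma exists_isMaxOn_feasibleMoments [IsProbabilityMeasure F] (hF : IsRunningLaw F)
    (h3 : Integrable (fun x : ℝ => |x| ^ 3) F) (σ : ℝ) {zt xzt : ℝ}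
    (hJ : (zt, xzt) ∈ inputSpace F) {Ψ : Matrix (Fin 4) (Fin 4) ℝ → EReal}
    (hΨ : ContinuousOn Ψ (infoMatrix F σ '' inputFeasible F)) :
    ∃ m ∈ feasibleMoments F zt xzt, ∀ n ∈ feasibleMoments F zt xzt,
      Ψ (infoOfMoments F σ n) ≤ Ψ (infoOfMoments F σ m) := by
  refine (isCompact_feasibleMoments h3 zt xzt).exists_isMaxOn (nonempty_feasibleMoments hF h3 hJ)
    (f := fun m => Ψ (infoOfMoments F σ m))
    (hΨ.comp (continuous_infoOfMoments σ).continuousOn fun m hm => ?_)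
  obtain ⟨p, hp, rfl⟩ := (mem_feasibleMoments_iff hF h3).1 hm
  refine ⟨p, ⟨hp.1, ?_⟩, infoMatrix_eq h3 σ hp.1⟩
  rwa [hp.2.1, hp.2.2]

/-- Every design has the same moments of order at most `2` as a design which minimizes
`∫ p * P` for some nonzero polynomial `P` of degree at most `3` whose cubic coefficient is
nonnegative, and which is therefore determined by the sign of `P` away from the zeros of `P`. -/
lemma exists_design_of_cubic_sign [IsFiniteMeasure F] (h3 : Integrable (fun x : ℝ => |x| ^ 3) F)
    {m : Fin 4 → ℝ} (hm : m ∈ designMoments F) :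
    ∃ p, IsDesign p ∧ (∀ i, i ≠ 3 → powerMoments F p i = m i) ∧
      ∃ c : Fin 4 → ℝ, c ≠ 0 ∧ 0 ≤ c 3 ∧
        (∀ q, IsDesign q → ∑ i, c i * powerMoments F p i ≤ ∑ i, c i * powerMoments F q i) ∧
        (∀ x : ℝ, ∑ i, c i * x ^ (i : ℕ) < 0 → p x = 1) ∧
        ∀ x : ℝ, 0 < ∑ i, c i * x ^ (i : ℕ) → p x = 0 := by
  -- The representative is chosen to minimize the third moment.
  have hT : IsCompact (designMoments F ∩ {n | ∀ i, i ≠ 3 → n i = m i}) := by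
    refine (isCompact_designMoments h3).inter_right ?_
    simp only [Set.ofPred_forall]
    exact isClosed_iInter fun i => isClosed_iInter fun _ =>
      isClosed_eq (continuous_apply i) continuous_const
  obtain ⟨n, ⟨hnK, hn⟩, hmin⟩ := hT.exists_isMinOn ⟨m, hm, fun _ _ => rfl⟩
    (continuous_apply (3 : Fin 4)).continuousOn
  simp only [Set.mem_ofPred_eq] at hn
  obtain ⟨c, hc0, hc3, hc⟩ := exists_multipliers (convex_designMoments h3) hnK 3
    fun k hk hkn => hmin ⟨hk, fun i hi => (hkn i hi).trans (hn i hi)⟩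
  obtain ⟨q, hq, rfl⟩ := mem_designMoments.1 hnK
  obtain ⟨p, hp, hpq, hp1, hp0⟩ := exists_ae_eq_of_isMinimizer (by fun_prop)
    (integrable_poly h3 c) hq fun r hr => by
      rw [integral_weight_mul_poly h3 hq, integral_weight_mul_poly h3 hr]
      exact hc _ (mem_designMoments.2 ⟨r, hr, rfl⟩)
  refine ⟨p, hp, ?_, c, hc0, hc3, ?_, hp1, hp0⟩
  · rwa [powerMoments_congr hpq]
  · intro r hr
    rw [powerMoments_congr hpq]
    exact hc _ (mem_designMoments.2 ⟨r, hr, rfl⟩)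

/-! ### The shape of the optimal design -/

lemma not_ae_eq_const [IsProbabilityMeasure F] (hF : IsRunningLaw F) (t : ℝ) :
    ¬ ∀ᵐ x ∂F, x = t := by
  intro h
  have := hF.var_pos
  rw [ProbabilityTheory.variance_congr (Y := fun _ => t) h,
    ProbabilityTheory.variance_eq_integral aemeasurable_const] at this
  simp at this

lemma sum_mul_pow_eq (c : Fin 4 → ℝ) (x : ℝ) :
    ∑ i, c i * x ^ (i : ℕ) = c 0 + c 1 * x + c 2 * x ^ 2 + c 3 * x ^ 3 := by
  simp [Fin.sum_univ_four]

lemma hasFourPieces_of_cubic {p : ℝ → ℝ} {c : Fin 4 → ℝ} (hc3 : 0 < c 3)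
    (hp1 : ∀ x : ℝ, ∑ i, c i * x ^ (i : ℕ) < 0 → p x = 1)
    (hp0 : ∀ x : ℝ, 0 < ∑ i, c i * x ^ (i : ℕ) → p x = 0) :
    ∃ a₁ a₂ a₃ : ℝ, a₁ ≤ a₂ ∧ a₂ ≤ a₃ ∧ HasFourPieces p a₁ a₂ a₃ := by
  obtain ⟨a₁, a₂, a₃, h12, h23, hs⟩ := exists_cubicSigns (c 2 / c 3) (c 1 / c 3) (c 0 / c 3)
  have hP : ∀ x : ℝ, ∑ i, c i * x ^ (i : ℕ) =
      c 3 * (x ^ 3 + c 2 / c 3 * x ^ 2 + c 1 / c 3 * x + c 0 / c 3) := fun x => by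
    rw [sum_mul_pow_eq]
    field_simp
    ring
  simp only [hP] at hp1 hp0
  refine ⟨a₁, a₂, a₃, h12, h23, fun x => ?_⟩
  obtain ⟨s1, s2, s3, s4⟩ := hs x
  simp only [EReal.coe_lt_coe_iff]
  exact ⟨fun h => hp1 x (mul_neg_of_pos_of_neg hc3 (s1 h)),
    fun h h' => hp0 x (mul_pos hc3 (s2 h h')),
    fun h h' => hp1 x (mul_neg_of_pos_of_neg hc3 (s3 h h')),
    fun h => hp0 x (mul_pos hc3 (s4 h))⟩

lemma isFinite_coe (a : ℝ) : IsFinite (a : EReal) := ⟨EReal.coe_ne_bot a, EReal.coe_ne_top a⟩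

/-- If the multiplier of the third moment vanishes and that of the second moment does not, the
design is an extremal one: it is `p_min` when the quadratic opens upwards and `p_max` when it opens
downwards. -/
lemma isPMin_or_isPMax_of_quadratic [IsProbabilityMeasure F] (hF : IsRunningLaw F)
    (h3 : Integrable (fun x : ℝ => |x| ^ 3) F) {zt xzt : ℝ} (hz1 : -1 < zt) (hz2 : zt < 1)
    {p : ℝ → ℝ} (hp : p ∈ feasible F zt xzt) {c : Fin 4 → ℝ} (hc3 : c 3 = 0) (hc2 : c 2 ≠ 0)
    (hmin : ∀ q, IsDesign q → ∑ i, c i * powerMoments F p i ≤ ∑ i, c i * powerMoments F q i)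
    (hp1 : ∀ x : ℝ, ∑ i, c i * x ^ (i : ℕ) < 0 → p x = 1)
    (hp0 : ∀ x : ℝ, 0 < ∑ i, c i * x ^ (i : ℕ) → p x = 0) :
    ∃ a₁ a₂ a₃ : EReal, a₁ ≤ a₂ ∧ a₂ ≤ a₃ ∧ HasFourPieces p a₁ a₂ a₃ ∧
      (IsPMax F zt xzt p ∨ IsPMin F zt xzt p) := by
  obtain ⟨hpd, hpz, hpxz⟩ := (mem_feasible_iff hF h3).1 hp
  have hne : ∀ r, (∀ x, p x = r) → r ≠ 0 ∧ r ≠ 1 := fun r h => by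
    have : powerMoments F p 0 = r := by
      rw [show p = fun _ => r from funext h, powerMoments_const_zero]
    constructor <;> rintro rfl <;> linarith
  have hP : ∀ x : ℝ, ∑ i, c i * x ^ (i : ℕ) =
      c 2 * (x ^ 2 + c 1 / c 2 * x + c 0 / c 2) := fun x => by
    rw [sum_mul_pow_eq, hc3]
    field_simp
    ring
  simp only [hP] at hp1 hp0
  have hle : ∀ q ∈ feasible F zt xzt, c 2 * powerMoments F p 2 ≤ c 2 * powerMoments F q 2 := by
    intro q hq
    obtain ⟨hqd, hqz, hqxz⟩ := (mem_feasible_iff hF h3).1 hq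
    have h0 : powerMoments F p 0 = powerMoments F q 0 := by linarith
    have h1 : powerMoments F p 1 = powerMoments F q 1 := by linarith
    have := hmin q hqd
    simp only [Fin.sum_univ_four, hc3, h0, h1] at this
    linarith
  rcases quadratic_factor_or_pos (c 1 / c 2) (c 0 / c 2) with ⟨s, t, hst, hq⟩ | hq
  · simp only [hq] at hp1 hp0
    have hin : ∀ x, s < x → x < t → (x - s) * (x - t) < 0 := fun x h h' =>
      mul_neg_of_pos_of_neg (by linarith) (by linarith)
    have hlt : ∀ x, x < s → 0 < (x - s) * (x - t) := fun x h =>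
      mul_pos_of_neg_of_neg (by linarith) (by linarith)
    have hgt : ∀ x, t < x → 0 < (x - s) * (x - t) := fun x h =>
      mul_pos (by linarith) (by linarith)
    have hout : ∀ x : ℝ, (x : EReal) ∉ Set.Icc (s : EReal) t → 0 < (x - s) * (x - t) := by
      intro x hx
      rw [Set.mem_Icc, EReal.coe_le_coe_iff, EReal.coe_le_coe_iff, not_and_or, not_le,
        not_le] at hx
      exact hx.elim (hlt x) (hgt x)
    rcases hc2.lt_or_gt with hneg | hpos
    · refine ⟨s, t, ⊤, EReal.coe_le_coe_iff.2 hst, le_top, fun x => ?_,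
        Or.inl ⟨⟨hp, fun q hq => ?_⟩, s, t, EReal.coe_le_coe_iff.2 hst, fun x hx => ?_,
          fun x hx => ?_,
        Or.inl ⟨isFinite_coe s, isFinite_coe t⟩⟩⟩
      · simp only [EReal.coe_lt_coe_iff]
        exact ⟨fun h => hp1 x (mul_neg_of_neg_of_pos hneg (hlt x h)),
          fun h h' => hp0 x (mul_pos_of_neg_of_neg hneg (hin x h h')),
          fun h _ => hp1 x (mul_neg_of_neg_of_pos hneg (hgt x h)),
          fun h => absurd h not_top_lt⟩
      · rw [meanXXZ_eq h3 hpd, meanXXZ_eq h3 hq.1]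
        have := (mul_le_mul_left_of_neg hneg).1 (hle q hq)
        linarith
      · exact hp1 x (mul_neg_of_neg_of_pos hneg (hout x hx))
      · exact hp0 x (mul_pos_of_neg_of_neg hneg
          (hin x (EReal.coe_lt_coe_iff.1 hx.1) (EReal.coe_lt_coe_iff.1 hx.2)))
    · refine ⟨⊥, s, t, bot_le, EReal.coe_le_coe_iff.2 hst, fun x => ?_,
        Or.inr ⟨⟨hp, fun q hq => ?_⟩, s, t, EReal.coe_le_coe_iff.2 hst, fun x hx => ?_,
          fun x hx => ?_,
        Or.inl ⟨isFinite_coe s, isFinite_coe t⟩⟩⟩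
      · simp only [EReal.coe_lt_coe_iff]
        exact ⟨fun h => absurd h not_lt_bot,
          fun _ h => hp0 x (mul_pos hpos (hlt x h)),
          fun h h' => hp1 x (mul_neg_of_pos_of_neg hpos (hin x h h')),
          fun h => hp0 x (mul_pos hpos (hgt x h))⟩
      · rw [meanXXZ_eq h3 hpd, meanXXZ_eq h3 hq.1]
        have := (mul_le_mul_iff_right₀ hpos).1 (hle q hq)
        linarith
      · exact hp1 x (mul_neg_of_pos_of_neg hpos
          (hin x (EReal.coe_lt_coe_iff.1 hx.1) (EReal.coe_lt_coe_iff.1 hx.2)))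
      · exact hp0 x (mul_pos hpos (hout x hx))
  · rcases hc2.lt_or_gt with hneg | hpos
    · exact absurd rfl (hne 1 fun x => hp1 x (mul_neg_of_neg_of_pos hneg (hq x))).2
    · exact absurd rfl (hne 0 fun x => hp0 x (mul_pos hpos (hq x))).1

/-- A design governed by the sign of a nonzero polynomial of degree at most one has maximal
short-term gain and is a threshold design, which is `p_max`. -/
lemma isPMax_of_linear [IsProbabilityMeasure F] (hF : IsRunningLaw F)
    (h3 : Integrable (fun x : ℝ => |x| ^ 3) F) {zt xzt : ℝ} (hJ : (zt, xzt) ∈ inputSpace F)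
    {p : ℝ → ℝ} (hp : p ∈ feasible F zt xzt) {c : Fin 4 → ℝ} (hc : c ≠ 0) (hc3 : c 3 = 0)
    (hc2 : c 2 = 0)
    (hmin : ∀ q, IsDesign q → ∑ i, c i * powerMoments F p i ≤ ∑ i, c i * powerMoments F q i)
    (hp1 : ∀ x : ℝ, ∑ i, c i * x ^ (i : ℕ) < 0 → p x = 1)
    (hp0 : ∀ x : ℝ, 0 < ∑ i, c i * x ^ (i : ℕ) → p x = 0) :
    ∃ t : ℝ, HasFourPieces p ⊥ t ⊤ ∧ IsPMax F zt xzt p := by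
  obtain ⟨hz1, hz2, hg0, hgmax⟩ := hJ
  simp only at hz1 hz2 hg0 hgmax
  obtain ⟨hpd, hpz, hpxz⟩ := (mem_feasible_iff hF h3).1 hp
  have hsum : ∀ n : Fin 4 → ℝ, ∑ i, c i * n i = c 0 * n 0 + c 1 * n 1 := fun n => by
    rw [Fin.sum_univ_four, hc3, hc2]; ring
  have hP : ∀ x : ℝ, ∑ i, c i * x ^ (i : ℕ) = c 0 + c 1 * x := fun x => by
    rw [hsum fun i => x ^ (i : ℕ)]; simp
  -- A design that does no worse than `p` is itself a minimizer and obeys the same sign rule.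
  have hae : ∀ q, IsDesign q →
      ∑ i, c i * powerMoments F q i ≤ ∑ i, c i * powerMoments F p i →
      ∀ᵐ x ∂F, (c 0 + c 1 * x < 0 → q x = 1) ∧ (0 < c 0 + c 1 * x → q x = 0) := by
    intro q hq hqp
    simp only [← hP]
    refine ae_eq_of_isMinimizer (by fun_prop) (integrable_poly h3 c) hq fun r hr => ?_
    rw [integral_weight_mul_poly h3 hq, integral_weight_mul_poly h3 hr]
    exact hqp.trans (hmin r hr)
  simp only [hsum] at hmin hae
  simp only [hP] at hp1 hp0
  -- With `0 ≤ c 1` the constant design of the same balance would be a minimizer too,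
  -- so that the polynomial would vanish almost everywhere.
  have hc1 : c 1 < 0 := by
    by_contra! hc1
    have hconst := hae (fun _ => (zt + 1) / 2) (isDesign_const (by linarith) (by linarith)) (by
      rw [powerMoments_const_zero, powerMoments_const_one hF,
        show powerMoments F p 0 = (zt + 1) / 2 by linarith]
      have : 0 ≤ c 1 * powerMoments F p 1 := mul_nonneg hc1 (by linarith)
      linarith)
    have hzero : ∀ᵐ x ∂F, c 0 + c 1 * x = 0 := by
      filter_upwards [hconst] with x hx
      by_contra! h
      rcases h.lt_or_gt with h | h
      · linarith [hx.1 h]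
      · linarith [hx.2 h]
    have hc1' : c 1 ≠ 0 := by
      intro h1
      obtain ⟨x, hx⟩ := hzero.exists
      rw [h1, zero_mul, add_zero] at hx
      refine hc (funext fun i => ?_)
      fin_cases i <;> simp [hx, h1, hc2, hc3]
    refine not_ae_eq_const hF (-c 0 / c 1) ?_
    filter_upwards [hzero] with x hx
    rw [eq_div_iff hc1']
    linarith
  set t := -c 0 / c 1 with ht
  have hPt : ∀ x, c 0 + c 1 * x = c 1 * (x - t) := fun x => by
    rw [ht, mul_sub, mul_div_cancel₀ _ hc1.ne]; ring
  simp only [hPt] at hp1 hp0 hae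
  have hgt : ∀ x, t < x → p x = 1 := fun x h => hp1 x (mul_neg_of_neg_of_pos hc1 (by linarith))
  have hlt : ∀ x, x < t → p x = 0 := fun x h => hp0 x (mul_pos_of_neg_of_neg hc1 (by linarith))
  have hgain : xzt = maxGain F zt := by
    refine le_antisymm hgmax (csSup_le ⟨_, p, ⟨hp.1, hp.2.1⟩, rfl⟩ ?_)
    rintro _ ⟨q, ⟨hq, hqz⟩, rfl⟩
    rw [meanZ_eq h3 hq] at hqz
    rw [meanXZ_eq hF h3 hq, ← hpxz]
    have h := hmin q hq
    rw [show powerMoments F q 0 = powerMoments F p 0 by linarith] at h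
    have := (mul_le_mul_left_of_neg hc1).1 (by linarith : c 1 * powerMoments F p 1 ≤ _)
    linarith
  refine ⟨t, fun x => ?_, ⟨hp, fun q hq => ?_⟩, ⊥, t, bot_le, fun x hx => ?_, fun x hx => ?_,
    Or.inr hgain⟩
  · simp only [EReal.coe_lt_coe_iff]
    exact ⟨fun h => absurd h not_lt_bot, fun _ h => hlt x h, fun h _ => hgt x h,
      fun h => absurd h not_top_lt⟩
  · -- Every feasible design agrees with `p` off `t`, hence has the same integral
    -- against `(x - t) ^ 2`.
    obtain ⟨hqd, hqz, hqxz⟩ := (mem_feasible_iff hF h3).1 hq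
    have h0 : powerMoments F q 0 = powerMoments F p 0 := by linarith
    have h1 : powerMoments F q 1 = powerMoments F p 1 := by linarith
    have hqae := hae q hqd (by rw [h0, h1])
    have hpoly : ∀ x : ℝ, ∑ i : Fin 4, (![t ^ 2, -2 * t, 1, 0] : Fin 4 → ℝ) i * x ^ (i : ℕ) =
        (x - t) ^ 2 := fun x => by
      rw [sum_mul_pow_eq]; simp; ring
    have heq : ∫ x, q x * (x - t) ^ 2 ∂F = ∫ x, p x * (x - t) ^ 2 ∂F := by
      refine integral_congr_ae ?_
      filter_upwards [hqae] with x hx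
      rcases lt_trichotomy x t with h | h | h
      · rw [hx.2 (mul_pos_of_neg_of_neg hc1 (by linarith)), hlt x h]
      · rw [h, sub_self]; ring
      · rw [hx.1 (mul_neg_of_neg_of_pos hc1 (by linarith)), hgt x h]
    simp only [← hpoly] at heq
    rw [integral_weight_mul_poly h3 hqd, integral_weight_mul_poly h3 hpd, Fin.sum_univ_four,
      Fin.sum_univ_four, h0, h1] at heq
    simp at heq
    rw [meanXXZ_eq h3 hpd, meanXXZ_eq h3 hqd, heq]
  · rw [Set.mem_Icc, not_and_or, not_le, not_le] at hx
    exact hx.elim (fun h => absurd h not_lt_bot) fun h => hgt x (EReal.coe_lt_coe_iff.1 h)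
  · exact hlt x (EReal.coe_lt_coe_iff.1 hx.2)

end TieBreaker

theorem theorem1 (F : MeasureTheory.Measure ℝ) [MeasureTheory.IsProbabilityMeasure F]
    (hF : TieBreaker.IsRunningLaw F)
    (h3 : MeasureTheory.Integrable (fun x : ℝ => |x| ^ 3) F)
    (σ : ℝ) (hσ : 0 < σ)
    (zt xzt : ℝ) (hJ : (zt, xzt) ∈ TieBreaker.inputSpace F)
    (Ψ : Matrix (Fin 4) (Fin 4) ℝ → EReal)
    (hΨ : ContinuousOn Ψ (TieBreaker.infoMatrix F σ '' TieBreaker.inputFeasible F)) :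
    ∃ p : ℝ → ℝ, TieBreaker.IsOptimalDesign F σ Ψ zt xzt p ∧
      ∃ a₁ a₂ a₃ : EReal, a₁ ≤ a₂ ∧ a₂ ≤ a₃ ∧
        TieBreaker.HasFourPieces p a₁ a₂ a₃ ∧
        ((TieBreaker.IsFinite a₁ ∧ TieBreaker.IsFinite a₂ ∧ TieBreaker.IsFinite a₃) ∨
          TieBreaker.IsPMax F zt xzt p ∨ TieBreaker.IsPMin F zt xzt p) := by
  open TieBreaker in
  obtain ⟨m, hm, hmax⟩ := exists_isMaxOn_feasibleMoments hF h3 σ hJ hΨ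
  obtain ⟨p, hp, hpm, c, hc, hc3, hmin, hp1, hp0⟩ := exists_design_of_cubic_sign h3 hm.1
  have hpf : p ∈ feasible F zt xzt := by
    rw [mem_feasible_iff hF h3, hpm 0 (by decide), hpm 1 (by decide)]
    exact ⟨hp, hm.2⟩
  refine ⟨p, ⟨hpf, fun q hq => ?_⟩, ?_⟩
  · rw [infoMatrix_eq h3 σ hq.1, infoMatrix_eq h3 σ hp, infoOfMoments_congr σ hpm]
    exact hmax _ ((mem_feasibleMoments_iff hF h3).2 ⟨q, hq, rfl⟩)
  · rcases hc3.eq_or_lt with h3z | h3p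
    · by_cases hc2 : c 2 = 0
      · obtain ⟨t, hfour, hP⟩ := isPMax_of_linear hF h3 hJ hpf hc h3z.symm hc2 hmin hp1 hp0
        exact ⟨⊥, t, ⊤, bot_le, le_top, hfour, Or.inr (Or.inl hP)⟩
      · obtain ⟨a₁, a₂, a₃, h12, h23, hfour, hP⟩ := isPMin_or_isPMax_of_quadratic hF h3 hJ.1
          hJ.2.1 hpf h3z.symm hc2 hmin hp1 hp0
        exact ⟨a₁, a₂, a₃, h12, h23, hfour, Or.inr hP⟩
    · obtain ⟨a₁, a₂, a₃, h12, h23, hfour⟩ := hasFourPieces_of_cubic h3p hp1 hp0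
      exact ⟨a₁, a₂, a₃, EReal.coe_le_coe_iff.2 h12, EReal.coe_le_coe_iff.2 h23, hfour,
        Or.inl ⟨isFinite_coe _, isFinite_coe _, isFinite_coe _⟩⟩
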